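/- A mixed class $\mathcal C=\bigcup_{n,m\ge 0}\mathcal C_{n,m}$ is a class of objects, where the objects $\gamma\in\mathcal C_{n,m}$ have $|\gamma|=n$ labelled atoms (with labels $1,\dots,n$) and $\|\gamma\|=m$ unlabelled atoms, such that every $\mathcal C_{n,m}$ is finite and closed under relabelling. Its generating function is $$C(x,y)=\sum_{\gamma\in\mathcal C}\frac{x^{|\gamma|}}{|\gamma|!}\,y^{\|\gamma\|}.$$ For $y>0$ let $\rho_C(y)$ be the radius of convergence of $x\mapsto C(x,y)$. A pair $(x,y)$ is admissible if $y>0$ and $0<x<\rho_C(y)$. A Boltzmann sampler $\Gamma\mathcal C(x,y)$ is a random procedure that, for every admissible $(x,y)$, outputs each $\gamma\in\mathcal C$ with probability $\frac{1}{C(x,y)}\frac{x^{|\gamma|}}{|\gamma|!}y^{\|\gamma\|}$. A singular point of $\mathcal C$ is a pair $x_0>0$, $y_0>0$ with $\rho_C(y_0)=x_0$. The class $\mathcal C$ has square-root singularities if for every singular point $(x_0,y_0)$ the function $z\mapsto C(z,y_0)$ extends analytically to a domain $\Delta=\{z\in\mathbb C: |z|<R,\ z\ne x_0,\ |\arg(z-x_0)|>\theta\}$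 for some $R>x_0$ and $0<\theta<\pi/2$ (in particular, $x_0$ is its only singularity on the circle $|z|=x_0$), and, as $z\to x_0$ in $\Delta$, $$C(z,y_0)=P(z)+c\,(x_0-z)^{1/2}+o\big((x_0-z)^{1/2}\big),$$ where $c\neq 0$ is a constant and $P$ is a rational function without poles in the disk $|z|\le x_0$. **Lemma.** Let $\mathcal C$ be a mixed class with square-root singularities, endowed with a Boltzmann sampler $\Gamma\mathcal C(x,y)$, and let $(x_0,y_0)$ be a singular point of $\mathcal C$. For $n\ge 1$ put $x_n=\big(1-\tfrac1{2n}\big)x_0$. Let $\gamma$ be the output of $\Gamma\mathcal C(x_n,y_0)$; let $\pi_n$ be the probability that $|\gamma|=n$, let $\pi_{n,\epsilon}$ (for $\epsilon>0$) be the probability that $|\gamma|\in[n(1-\epsilon),n(1+\epsilon)]$, and let $\sigma_n$ be the expectation of $|\gamma|$. Then, as $n\to\infty$, 1. $1/\pi_n=O(n^{3/2})$; 2. $1/\pi_{n,\epsilon}=O(n^{1/2}/\epsilon)$, with a constant that does not depend on $\epsilon$ and uniformly for $\epsilon$ in bounded ranges: there is a constant $K$ such that for every $E>0$ there is an $N$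 with $1/\pi_{n,\epsilon}\le K n^{1/2}/\epsilon$ for all $n\ge N$ and all $0<\epsilon\le E$; 3. $\sigma_n=O(n^{1/2})$. In particular, $\pi_n$ and $\pi_{n,\epsilon}$ are positive and $\sigma_n$ is finite for all large $n$. The constants may depend on $\mathcal C$, $x_0$ and $y_0$. -/

import Mathlib

open Filter Topology
open scoped ENNReal NNReal Nat

universe u

/-- A mixed combinatorial class: `Obj n m` is the set of objects with `n` labelled atoms
(bearing the labels of `Fin n`) and `m` unlabelled atoms. There are finitely many objects of each
size, and the class is closed under relabelling: the permutations of the labels act on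
the objects. -/
structure MixedClass where
  Obj : ℕ → ℕ → Type u
  finite : ∀ n m, Finite (Obj n m)
  relabel : ∀ n m, MulAction (Equiv.Perm (Fin n)) (Obj n m)

namespace MixedClass

/-- The set of all objects of the class, `⋃ C_{n,m}`. -/
def Object (C : MixedClass.{u}) : Type u := Σ p : ℕ × ℕ, C.Obj p.1 p.2

variable (C : MixedClass.{u})

/-- The L-size `|γ|`: the number of labelled atoms. -/
def lsize (γ : C.Object) : ℕ := γ.1.1

/-- The U-size `‖γ‖`: the number of unlabelled atoms. -/
def usize (γ : C.Object) : ℕ := γ.1.2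

/-- The contribution `x ^ |γ| / |γ|! * y ^ ‖γ‖` of the object `γ` to the mixed generating function
(at a real or a complex point). -/
noncomputable def term {𝕜 : Type*} [RCLike 𝕜] (x y : 𝕜) (γ : C.Object) : 𝕜 :=
  x ^ C.lsize γ / ((C.lsize γ)! : 𝕜) * y ^ C.usize γ

/-- The mixed generating function `C(x, y)`. -/
noncomputable def genFun {𝕜 : Type*} [RCLike 𝕜] (x y : 𝕜) : 𝕜 :=
  ∑' γ : C.Object, C.term x y γ

/-- The radius of convergence of `x ↦ C(x, y)`, for `y > 0`: all terms being nonnegative on the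
positive axis, it is the supremum of the `r ≥ 0` at which the series converges. -/
noncomputable def radius (y : ℝ) : ℝ≥0∞ :=
  ⨆ (r : ℝ≥0) (_ : Summable fun γ : C.Object => C.term (r : ℝ) y γ), (r : ℝ≥0∞)

/-- `(x, y)` is admissible if `x, y > 0` and `x` is smaller than the radius of convergence. -/
def Admissible (x y : ℝ) : Prop :=
  0 < x ∧ 0 < y ∧ ENNReal.ofReal x < C.radius y

/-- A Boltzmann sampler: a random procedure with parameters `x, y` (represented by the law of
its output) that, for admissible `(x, y)`, outputs each object `γ` with probability
`(x ^ |γ| / |γ|! * y ^ ‖γ‖) / C(x, y)`. -/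
def IsBoltzmannSampler (Γ : ℝ → ℝ → PMF C.Object) : Prop :=
  ∀ x y : ℝ, C.Admissible x y →
    ∀ γ : C.Object, Γ x y γ = ENNReal.ofReal (C.term x y γ / C.genFun x y)

/-- `(x₀, y₀)` is a singular point: `x₀, y₀ > 0` and `x ↦ C(x, y₀)` has radius of convergence `x₀`
(equivalently, as the coefficients are nonnegative, it has a dominant singularity at `x₀`). -/
def IsSingularPoint (x₀ y₀ : ℝ) : Prop :=
  0 < x₀ ∧ 0 < y₀ ∧ C.radius y₀ = ENNReal.ofReal x₀

end MixedClass

/-- The `Δ`-domain `{z : |z| < R, z ≠ x₀, |arg (z - x₀)| > θ}` at `x₀`. -/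
def deltaDomain (x₀ R θ : ℝ) : Set ℂ :=
  {z : ℂ | ‖z‖ < R ∧ z ≠ (x₀ : ℂ) ∧ θ < |Complex.arg (z - (x₀ : ℂ))|}

namespace MixedClass

variable (C : MixedClass.{u})

/-- The class is `α`-singular. For every singular point `(x₀, y₀)`, the function `z ↦ C(z, y₀)`
extends to an analytic function `f` on a `Δ`-domain at `x₀` of outer radius `R > x₀` (which contains
the closed disk `|z| ≤ x₀` except the point `x₀`, so that `x₀` is the only singularity on the
circle `|z| = x₀`), and there
`f z = P z + c * (x₀ - z) ^ α + o((x₀ - z) ^ α)` as `z → x₀`, with `c ≠ 0` and with a rational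
function `P = p / q` that has no pole in the disk `|z| ≤ x₀`. -/
def IsAlphaSingular (α : ℝ) : Prop :=
  (∀ k : ℕ, α ≠ k) ∧
  ∀ x₀ y₀ : ℝ, C.IsSingularPoint x₀ y₀ →
    ∃ (R θ : ℝ) (f : ℂ → ℂ) (p q : Polynomial ℂ) (c : ℂ),
      x₀ < R ∧ 0 < θ ∧ θ < Real.pi / 2 ∧
      AnalyticOnNhd ℂ f (deltaDomain x₀ R θ) ∧
      (∀ z : ℂ, ‖z‖ < x₀ → f z = C.genFun z (y₀ : ℂ)) ∧
      (∀ z : ℂ, ‖z‖ ≤ x₀ → q.eval z ≠ 0) ∧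
      c ≠ 0 ∧
      (fun z : ℂ => f z - (p.eval z / q.eval z + c * ((x₀ : ℂ) - z) ^ (α : ℂ)))
        =o[𝓝[deltaDomain x₀ R θ] (x₀ : ℂ)] fun z : ℂ => ((x₀ : ℂ) - z) ^ (α : ℂ)

/-- The class has square-root singularities. -/
def HasSquareRootSingularities : Prop := C.IsAlphaSingular (1 / 2)

variable {C}

/-- The probability that the L-size of a random object lies in the set `S`. -/
noncomputable def probSize (μ : PMF C.Object) (S : Set ℕ) : ℝ≥0∞ :=
  μ.toOuterMeasure {γ | C.lsize γ ∈ S}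

/-- The expected L-size of a random object (possibly infinite). -/
noncomputable def expectedSize (μ : PMF C.Object) : ℝ≥0∞ :=
  ∑' γ : C.Object, μ γ * (C.lsize γ : ℝ≥0∞)

end MixedClass

/-- The tuned parameter `x_n = (1 - 1 / (2 n)) x₀`. -/
noncomputable def tunedParam (x₀ : ℝ) (n : ℕ) : ℝ := (1 - 1 / (2 * (n : ℝ))) * x₀

/-- The sizes in `I_{n,ε} = [n (1 - ε), n (1 + ε)]`. -/
def sizeWindow (n : ℕ) (ε : ℝ) : Set ℕ :=
  {k : ℕ | (n : ℝ) * (1 - ε) ≤ k ∧ (k : ℝ) ≤ n * (1 + ε)}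

/-! Write c_k for the coefficient of x^k in C(x, y₀). Everything follows from two facts: c_k x₀^k ≥
δ k^(-3/2) for large k, and |C(x, y₀) - L| = O((x₀ - x)^(1/2)) as x → x₀ from below. The second is
read off the singular expansion. The first is a transfer theorem, proved here without a Hankel
contour. Put g = f - c (x₀ - z)^(1/2). The coefficients of the square root are bounded below
explicitly, so those of g need only be o(n^(-3/2) x₀^(-n)). Cauchy estimates on small disks around
z, which fit in the Δ-domain, give g''' = o(|x₀ - z|^(-5/2)) up to a bounded term. The bounded term
absorbs P, of which only analyticity at x₀ is used. The mean of |x₀ - z|^(-5/2) over the circle of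
radius x₀ n/(n+1) is O(n^(3/2)) by the Poisson kernel, while three derivatives gain n^(-3). For the
sampler, C(x_n, y₀) stays between positive constants and x_n^k ≥ x₀^k / 4 for k ≤ 2n, so each size
in [n, 2n] has probability at least p n^(-3/2). This gives 1, and summing over the right half of the
window gives 2 for ε ≤ 1. For 3, convexity bounds the mean by a difference quotient of C between x_n
and x_(2n): an increment O(n^(-1/2)) over a gap of order 1/n. -/

/-! ### Coefficient bounds from circle averages -/

-- Poisson kernel: on |z| = r the real part of (ρ + z)/(ρ - z) is (ρ² - r²)/|ρ - z|², and its mean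
-- is the value 1 at the centre.
open Complex Metric in
theorem circleAverage_inv_norm_sub_sq {ρ r : ℝ} (hr : 0 < r) (hrρ : r < ρ) :
    Real.circleAverage (fun z : ℂ => (‖(ρ : ℂ) - z‖ ^ 2)⁻¹) 0 r = (ρ ^ 2 - r ^ 2)⁻¹ := by
  have hne : ∀ z ∈ closedBall (0 : ℂ) r, (ρ : ℂ) - z ≠ 0 := by
    intro z hz h
    have : z = ρ := (sub_eq_zero.mp h).symm
    rw [this, mem_closedBall_zero_iff, norm_real, Real.norm_of_nonneg (by linarith)] at hz
    linarith
  have hd : DifferentiableOn ℂ (fun z : ℂ => ((ρ : ℂ) + z) / (ρ - z)) (closedBall 0 r) := by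
    refine DifferentiableOn.div (by fun_prop) (by fun_prop) hne
  have hsph : sphere (0 : ℂ) |r| ⊆ closedBall 0 r := by
    rw [abs_of_pos hr]; exact sphere_subset_closedBall
  have hm : Real.circleAverage (fun z : ℂ => ((ρ : ℂ) + z) / (ρ - z)) 0 r = 1 := by
    have h1 : DiffContOnCl ℂ (fun z : ℂ => ((ρ : ℂ) + z) / (ρ - z)) (ball 0 |r|) := by
      refine DifferentiableOn.diffContOnCl (hd.mono ?_)
      rw [abs_of_pos hr]; exact closure_ball_subset_closedBall
    rw [h1.circleAverage]
    have : (ρ : ℂ) ≠ 0 := by exact_mod_cast (by linarith : ρ ≠ 0)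
    simp [this]
  have hi : CircleIntegrable (fun z : ℂ => ((ρ : ℂ) + z) / (ρ - z)) 0 r :=
    ContinuousOn.circleIntegrable' (hd.continuousOn.mono hsph)
  have hre := Complex.reCLM.circleAverage_comp_comm hi
  rw [hm] at hre
  have hpos : 0 < ρ ^ 2 - r ^ 2 := by nlinarith
  have hcongr : Set.EqOn (Complex.reCLM ∘ fun z : ℂ => ((ρ : ℂ) + z) / (ρ - z))
      (fun z => (ρ ^ 2 - r ^ 2) • (‖(ρ : ℂ) - z‖ ^ 2)⁻¹) (sphere (0 : ℂ) |r|) := by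
    intro z hz
    have hz' : Complex.normSq z = r ^ 2 := by
      rw [mem_sphere_zero_iff_norm, abs_of_pos hr] at hz
      rw [Complex.normSq_eq_norm_sq, hz]
    have hn0 : Complex.normSq ((ρ : ℂ) - z) ≠ 0 := by
      simpa using hne z (hsph hz)
    simp only [Function.comp_apply, Complex.reCLM_apply, Complex.div_re, smul_eq_mul,
      ← Complex.normSq_eq_norm_sq]
    rw [← hz']
    field_simp
    simp [Complex.normSq_apply]
    ring
  rw [Real.circleAverage_congr_sphere hcongr, Real.circleAverage_fun_smul] at hre
  simp only [smul_eq_mul, Complex.reCLM_apply, Complex.one_re] at hre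
  exact eq_inv_of_mul_eq_one_right hre

-- Cauchy's estimate with the mean of |G| in place of its maximum; the maximum would lose a factor n
-- near the singularity.
open Complex Metric in
theorem norm_iteratedDeriv_zero_le_circleAverage {G : ℂ → ℂ} {r : ℝ} (hr : 0 < r)
    (hG : DifferentiableOn ℂ G (closedBall 0 r)) (n : ℕ) :
    ‖iteratedDeriv n G 0‖ ≤ n ! * (Real.circleAverage (fun z => ‖G z‖) 0 r / r ^ n) := by
  have h1 : HasFPowerSeriesOnBall G (cauchyPowerSeries G 0 r) 0 (r.toNNReal : ℝ≥0∞) := by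
    have := DifferentiableOn.hasFPowerSeriesOnBall (R := r.toNNReal) (c := 0) (f := G)
      (by rwa [Real.coe_toNNReal r hr.le]) (by simpa using hr)
    rwa [Real.coe_toNNReal r hr.le] at this
  have h2 := h1.hasFPowerSeriesAt.eq_formalMultilinearSeries
    h1.hasFPowerSeriesAt.analyticAt.hasFPowerSeriesAt
  have h3 := norm_cauchyPowerSeries_le G 0 r n
  rw [h2, FormalMultilinearSeries.norm_apply_eq_norm_coef, FormalMultilinearSeries.coeff_ofScalars,
    norm_div, Complex.norm_natCast, abs_of_pos hr, div_le_iff₀ (by positivity)] at h3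
  rw [Real.circleAverage_def, smul_eq_mul]
  calc _ ≤ _ := h3
    _ = _ := by rw [inv_pow]; ring

theorem one_add_inv_pow_le_three (n : ℕ) : ((n + 1 : ℝ) / (n : ℝ)) ^ n ≤ 3 := by
  rcases Nat.eq_zero_or_pos n with rfl | hn
  · norm_num
  have hn' : (0 : ℝ) < n := by exact_mod_cast hn
  calc ((n + 1 : ℝ) / (n : ℝ)) ^ n = (1 / n + 1 : ℝ) ^ n := by congr 1; field_simp; ring
    _ ≤ (Real.exp (1 / n)) ^ n := by gcongr; exact Real.add_one_le_exp _
    _ = Real.exp 1 := by rw [← Real.exp_nat_mul]; congr 1; field_simp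
    _ ≤ 3 := by linarith [Real.exp_one_lt_d9]

open Complex Metric in
/-- If `g'''` is bounded by `ε |ρ - z| ^ (-5/2) + M` on the disk of radius `ρ`, then the Taylor
coefficient of order `n + 3` of `g` is at most of order `ε n ^ (-3/2) ρ ^ (-n)`. -/
theorem norm_iteratedDeriv_add_three_le {g : ℂ → ℂ} {ρ ε M : ℝ} (hρ : 0 < ρ) (hε : 0 ≤ ε)
    (hg : DifferentiableOn ℂ (iteratedDeriv 3 g) (ball 0 ρ))
    (hb : ∀ z ∈ ball (0 : ℂ) ρ,
      ‖iteratedDeriv 3 g z‖ ≤ ε * ‖(ρ : ℂ) - z‖ ^ (-(5 / 2) : ℝ) + M) {n : ℕ} (hn : 0 < n) :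
    ‖iteratedDeriv (n + 3) g 0‖ * ρ ^ n ≤
      n ! * (3 * (ε * ρ ^ (-(5 / 2) : ℝ) * (n + 1 : ℝ) ^ (3 / 2 : ℝ) + M)) := by
  have hn' : (0 : ℝ) < n := by exact_mod_cast hn
  -- The circle of radius r = ρ n/(n+1) stays at distance at least d from ρ, while (ρ/r)^n ≤ 3.
  set d : ℝ := ρ / (n + 1) with hd
  have hd0 : 0 < d := by positivity
  set r : ℝ := ρ - d with hr
  have hr' : r = ρ * (n / (n + 1)) := by rw [hr, hd]; field_simp; ring
  have hr0 : 0 < r := by rw [hr']; positivity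
  have hrρ : r < ρ := by linarith
  have hsub : closedBall (0 : ℂ) r ⊆ ball 0 ρ := closedBall_subset_ball hrρ
  have hsph : sphere (0 : ℂ) |r| ⊆ closedBall 0 r := by
    rw [abs_of_pos hr0]; exact sphere_subset_closedBall
  have hiter : iteratedDeriv (n + 3) g = iteratedDeriv n (iteratedDeriv 3 g) := by
    simp only [iteratedDeriv_eq_iterate, Function.iterate_add_apply]
  have h1 := norm_iteratedDeriv_zero_le_circleAverage hr0 (hg.mono hsub) n
  rw [← hiter] at h1
  have hnorm : ∀ z ∈ sphere (0 : ℂ) |r|, d ≤ ‖(ρ : ℂ) - z‖ := by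
    intro z hz
    rw [mem_sphere_zero_iff_norm, abs_of_pos hr0] at hz
    have := norm_sub_norm_le (ρ : ℂ) z
    rw [norm_real, Real.norm_of_nonneg hρ.le, hz] at this
    linarith
  have hcont : ContinuousOn (fun z : ℂ => (‖(ρ : ℂ) - z‖ ^ 2)⁻¹) (sphere (0 : ℂ) |r|) := by
    refine ContinuousOn.inv₀ (by fun_prop) fun z hz => ?_
    have := hnorm z hz
    have : 0 < ‖(ρ : ℂ) - z‖ := by linarith
    positivity
  have hci2 : CircleIntegrable (fun z : ℂ => ε * d ^ (-(1 / 2) : ℝ) * (‖(ρ : ℂ) - z‖ ^ 2)⁻¹ + M)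
      0 r :=
    ContinuousOn.circleIntegrable' ((continuousOn_const.mul hcont).add continuousOn_const)
  have h2 : Real.circleAverage (fun z => ‖iteratedDeriv 3 g z‖) 0 r ≤
      Real.circleAverage
        (fun z : ℂ => ε * d ^ (-(1 / 2) : ℝ) * (‖(ρ : ℂ) - z‖ ^ 2)⁻¹ + M) 0 r := by
    refine Real.circleAverage_mono
      (ContinuousOn.circleIntegrable' ((hg.continuousOn.mono (hsph.trans hsub)).norm)) hci2 ?_
    intro z hz
    refine (hb z (hsub (hsph hz))).trans ?_
    have hz1 := hnorm z hz
    have hz0 : 0 < ‖(ρ : ℂ) - z‖ := by linarith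
    -- Split off the exponent -2, whose mean is known exactly, and bound the remaining power -1/2 by
    -- its value at distance d.
    have e1 : ‖(ρ : ℂ) - z‖ ^ (-(5 / 2) : ℝ) =
        ‖(ρ : ℂ) - z‖ ^ (-(1 / 2) : ℝ) * (‖(ρ : ℂ) - z‖ ^ 2)⁻¹ := by
      rw [← Real.rpow_natCast, ← Real.rpow_neg hz0.le, ← Real.rpow_add hz0]; norm_num
    have e2 : ‖(ρ : ℂ) - z‖ ^ (-(1 / 2) : ℝ) ≤ d ^ (-(1 / 2) : ℝ) :=
      Real.rpow_le_rpow_of_nonpos hd0 hz1 (by norm_num)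
    rw [e1, mul_assoc]
    gcongr
  have h3 : Real.circleAverage
        (fun z : ℂ => ε * d ^ (-(1 / 2) : ℝ) * (‖(ρ : ℂ) - z‖ ^ 2)⁻¹ + M) 0 r =
      ε * d ^ (-(1 / 2) : ℝ) * (ρ ^ 2 - r ^ 2)⁻¹ + M := by
    rw [Real.circleAverage_fun_add
      (f₁ := fun z : ℂ => ε * d ^ (-(1 / 2) : ℝ) * (‖(ρ : ℂ) - z‖ ^ 2)⁻¹)
      (ContinuousOn.circleIntegrable' (continuousOn_const.mul hcont))
      (ContinuousOn.circleIntegrable' continuousOn_const), Real.circleAverage_const,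
      ← circleAverage_inv_norm_sub_sq hr0 hrρ]
    simp_rw [← smul_eq_mul]
    rw [Real.circleAverage_fun_smul]
  have h4 : d ^ (-(1 / 2) : ℝ) * (ρ ^ 2 - r ^ 2)⁻¹ ≤
      ρ ^ (-(5 / 2) : ℝ) * (n + 1 : ℝ) ^ (3 / 2 : ℝ) := by
    have : ρ * d ≤ ρ ^ 2 - r ^ 2 := by rw [hr]; nlinarith
    calc d ^ (-(1 / 2) : ℝ) * (ρ ^ 2 - r ^ 2)⁻¹ ≤ d ^ (-(1 / 2) : ℝ) * (ρ * d)⁻¹ := by gcongr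
      _ = ρ⁻¹ * d ^ (-(3 / 2) : ℝ) := by
        rw [mul_inv, mul_left_comm, ← Real.rpow_neg_one d, ← Real.rpow_add hd0]; norm_num
      _ = _ := by
        rw [hd, Real.div_rpow hρ.le (by positivity), Real.rpow_neg (x := (n : ℝ) + 1) (by positivity), div_inv_eq_mul,
          ← mul_assoc, ← Real.rpow_neg_one ρ, ← Real.rpow_add hρ]; norm_num
  have h5 : Real.circleAverage (fun z => ‖iteratedDeriv 3 g z‖) 0 r ≤
      ε * ρ ^ (-(5 / 2) : ℝ) * (n + 1 : ℝ) ^ (3 / 2 : ℝ) + M := by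
    rw [h3] at h2
    refine h2.trans ?_
    rw [mul_assoc, mul_assoc]
    gcongr
  have h0 : 0 ≤ Real.circleAverage (fun z => ‖iteratedDeriv 3 g z‖) 0 r :=
    Real.circleAverage_nonneg_of_nonneg fun _ _ => norm_nonneg _
  calc ‖iteratedDeriv (n + 3) g 0‖ * ρ ^ n
      ≤ (n ! * (Real.circleAverage (fun z => ‖iteratedDeriv 3 g z‖) 0 r / r ^ n)) * ρ ^ n := by
        gcongr
    _ = n ! * (((n + 1 : ℝ) / (n : ℝ)) ^ n *
          Real.circleAverage (fun z => ‖iteratedDeriv 3 g z‖) 0 r) := by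
        rw [hr', mul_pow, div_pow, div_pow]; field_simp
    _ ≤ _ := by
        gcongr
        exact one_add_inv_pow_le_three n

open Complex Metric in
/-- Transfer from `g''' = o(|ρ - z| ^ (-5/2))` to the coefficients of `g`. -/
theorem eventually_norm_coeff_le {g : ℂ → ℂ} {ρ : ℝ} (hρ : 0 < ρ)
    (hg : DifferentiableOn ℂ (iteratedDeriv 3 g) (ball 0 ρ))
    (hb : ∀ ε : ℝ, 0 < ε → ∃ M : ℝ, ∀ z ∈ ball (0 : ℂ) ρ,
      ‖iteratedDeriv 3 g z‖ ≤ ε * ‖(ρ : ℂ) - z‖ ^ (-(5 / 2) : ℝ) + M) {η : ℝ} (hη : 0 < η) :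
    ∀ᶠ n : ℕ in atTop,
      ‖iteratedDeriv n g 0‖ / n ! * ρ ^ n ≤ η * (n : ℝ) ^ (-(3 / 2) : ℝ) := by
  -- 48 = 6 · 8: the factor 3 of the previous bound doubles when M is absorbed for large n, and
  -- (n+3)^(3/2) ≤ 8 (n+1)^(3/2).
  set ε : ℝ := η / (48 * ρ ^ 3 * ρ ^ (-(5 / 2) : ℝ)) with hε
  have hε0 : 0 < ε := by positivity
  obtain ⟨M, hM⟩ := hb ε hε0
  have hlim : Tendsto (fun n : ℕ => (n + 1 : ℝ) ^ (3 / 2 : ℝ)) atTop atTop :=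
    (tendsto_rpow_atTop (by norm_num)).comp
      (tendsto_atTop_add_const_right _ _ tendsto_natCast_atTop_atTop)
  have hev := hlim.eventually_ge_atTop (M / (ε * ρ ^ (-(5 / 2) : ℝ)))
  rw [← map_add_atTop_eq_nat 3, eventually_map]
  filter_upwards [hev, eventually_gt_atTop 0] with n hn hn0
  have h1 := norm_iteratedDeriv_add_three_le hρ hε0.le hg hM hn0
  rw [div_le_iff₀ (by positivity)] at hn
  set A : ℝ := (n + 1 : ℝ) ^ (3 / 2 : ℝ) with hA
  have hA0 : 0 < A := by positivity
  have h2 : ‖iteratedDeriv (n + 3) g 0‖ * ρ ^ n ≤ n ! * (6 * (ε * ρ ^ (-(5 / 2) : ℝ) * A)) := by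
    refine h1.trans (mul_le_mul_of_nonneg_left ?_ (by positivity))
    linarith
  have hA2 : A ^ 2 = (n + 1 : ℝ) ^ 3 := by
    rw [hA, ← Real.rpow_natCast, ← Real.rpow_mul (by positivity), ← Real.rpow_natCast]; norm_num
  have hB : ((n + 3 : ℕ) : ℝ) ^ (3 / 2 : ℝ) ≤ 8 * A := by
    calc ((n + 3 : ℕ) : ℝ) ^ (3 / 2 : ℝ) ≤ (4 * (n + 1 : ℝ)) ^ (3 / 2 : ℝ) := by
          gcongr; push_cast; linarith [(Nat.cast_nonneg n : (0 : ℝ) ≤ n)]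
      _ = 8 * A := by
          rw [Real.mul_rpow (by norm_num) (by positivity)]
          congr 1
          rw [show (4 : ℝ) = 2 ^ (2 : ℝ) by norm_num, ← Real.rpow_mul (by norm_num)]
          norm_num
  have hfac : ((n + 3) ! : ℝ) ≥ n ! * A ^ 2 := by
    rw [hA2, Nat.factorial_succ, Nat.factorial_succ, Nat.factorial_succ]
    push_cast
    have : (0 : ℝ) < n ! := by positivity
    have hnn : (0 : ℝ) ≤ n := Nat.cast_nonneg n
    have : ((n : ℝ) + 1) ^ 3 ≤ (n + 2 + 1) * ((n + 1 + 1) * (n + 1)) := by nlinarith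
    nlinarith
  have hB0 : 0 < ((n + 3 : ℕ) : ℝ) ^ (3 / 2 : ℝ) := by positivity
  rw [Real.rpow_neg (by positivity), div_mul_eq_mul_div, div_le_iff₀ (by positivity),
    ← div_eq_mul_inv, div_mul_eq_mul_div, le_div_iff₀ hB0]
  have h3 : 48 * ρ ^ 3 * (ε * ρ ^ (-(5 / 2) : ℝ)) = η := by rw [hε]; field_simp
  calc ‖iteratedDeriv (n + 3) g 0‖ * ρ ^ (n + 3) * ((n + 3 : ℕ) : ℝ) ^ (3 / 2 : ℝ)
      = (‖iteratedDeriv (n + 3) g 0‖ * ρ ^ n) * ρ ^ 3 * ((n + 3 : ℕ) : ℝ) ^ (3 / 2 : ℝ) := by ring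
    _ ≤ (n ! * (6 * (ε * ρ ^ (-(5 / 2) : ℝ) * A))) * ρ ^ 3 * (8 * A) := by gcongr
    _ = (48 * ρ ^ 3 * (ε * ρ ^ (-(5 / 2) : ℝ))) * (n ! * A ^ 2) := by ring
    _ ≤ η * (n + 3)! := by rw [h3]; gcongr

/-! ### Coefficients of the square root -/

theorem sub_mem_slitPlane_of_norm_lt {ρ : ℝ} {z : ℂ} (hz : ‖z‖ < ρ) :
    (ρ : ℂ) - z ∈ Complex.slitPlane := by
  left
  have := Complex.re_le_norm z
  simp
  linarith

open Complex Metric in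
theorem iteratedDeriv_sub_cpow {ρ : ℝ} (a : ℂ) (n : ℕ) : ∀ z ∈ ball (0 : ℂ) ρ,
    iteratedDeriv n (fun z : ℂ => ((ρ : ℂ) - z) ^ a) z =
      (∏ k ∈ Finset.range n, (k - a)) * ((ρ : ℂ) - z) ^ (a - n) := by
  induction n with
  | zero => simp
  | succ n ih =>
    intro z hz
    have hev : iteratedDeriv n (fun z : ℂ => ((ρ : ℂ) - z) ^ a) =ᶠ[𝓝 z]
        fun z => (∏ k ∈ Finset.range n, (k - a)) * ((ρ : ℂ) - z) ^ (a - n) :=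
      Filter.eventuallyEq_of_mem (isOpen_ball.mem_nhds hz) ih
    have hs : (ρ : ℂ) - z ∈ slitPlane := sub_mem_slitPlane_of_norm_lt (by simpa using hz)
    have hd : HasDerivAt (fun z : ℂ => ((ρ : ℂ) - z) ^ (a - n))
        ((a - n) * ((ρ : ℂ) - z) ^ (a - n - 1) * (-1)) z :=
      HasDerivAt.cpow_const ((hasDerivAt_id z).const_sub (ρ : ℂ)) hs
    rw [iteratedDeriv_succ, hev.deriv_eq, (hd.const_mul _).deriv, Finset.prod_range_succ]
    push_cast
    rw [show a - (n + 1) = a - n - 1 by ring]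
    ring

/-- The right-hand side equals 1/4 at n = 1 and is nondecreasing: consecutive values have ratio
(2n+1)² / (4n(n+1)) ≥ 1. Squaring avoids half-integer powers in the induction. -/
theorem quarter_le_prod_sq (n : ℕ) (hn : 1 ≤ n) :
    1 / 4 ≤ (‖∏ k ∈ Finset.range n, ((k : ℂ) - ((1 / 2 : ℝ) : ℂ))‖ / n !) ^ 2 *
      (n * (2 * n - 1) ^ 2) := by
  induction n, hn using Nat.le_induction with
  | base => norm_num
  | succ n hn ih =>
    refine ih.trans ?_
    have h1 : (1 : ℝ) ≤ n := by exact_mod_cast hn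
    have h2 : ‖(n : ℂ) - ((1 / 2 : ℝ) : ℂ)‖ = n - 1 / 2 := by
      rw [← Complex.ofReal_natCast, ← Complex.ofReal_sub, Complex.norm_real,
        Real.norm_of_nonneg (by linarith)]
    rw [Finset.prod_range_succ, norm_mul, h2, Nat.factorial_succ]
    set A := ‖∏ k ∈ Finset.range n, ((k : ℂ) - ((1 / 2 : ℝ) : ℂ))‖ / n ! with hA
    have h3 : ‖∏ k ∈ Finset.range n, ((k : ℂ) - ((1 / 2 : ℝ) : ℂ))‖ * (n - 1 / 2) /
        ((n + 1) * n ! : ℕ) = A * ((n - 1 / 2) / (n + 1)) := by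
      rw [hA]
      generalize ‖∏ k ∈ Finset.range n, ((k : ℂ) - ((1 / 2 : ℝ) : ℂ))‖ = B
      push_cast
      field_simp
    rw [h3, mul_pow, mul_assoc]
    refine mul_le_mul_of_nonneg_left ?_ (sq_nonneg A)
    push_cast
    rw [div_pow, div_mul_eq_mul_div, le_div_iff₀ (by positivity)]
    have : (2 * (n : ℝ) - 1) ^ 2 * (n + 1) * (n * (n + 1)) ≤
      (2 * (n : ℝ) - 1) ^ 2 * (n + 1) * ((2 * n + 1) ^ 2 / 4) := by
      gcongr
      nlinarith
    nlinarith

/-- The coefficients of `(ρ - z) ^ (1/2)` are at least of order `n ^ (-3/2) ρ ^ (-n)`. -/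
theorem le_norm_coeff_sqrt {ρ : ℝ} (hρ : 0 < ρ) (n : ℕ) (hn : 1 ≤ n) :
    ρ ^ (1 / 2 : ℝ) / 4 * (n : ℝ) ^ (-(3 / 2) : ℝ) ≤
      ‖iteratedDeriv n (fun z : ℂ => ((ρ : ℂ) - z) ^ (((1 / 2 : ℝ) : ℝ) : ℂ)) 0‖ / n ! * ρ ^ n := by
  have h1 : (1 : ℝ) ≤ n := by exact_mod_cast hn
  rw [iteratedDeriv_sub_cpow _ _ 0 (by simpa using hρ), sub_zero, norm_mul,
    show (((1 / 2 : ℝ) : ℝ) : ℂ) - n = (((1 / 2 - n : ℝ)) : ℂ) by push_cast; ring,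
    Complex.norm_cpow_real, Complex.norm_real, Real.norm_of_nonneg hρ.le, Real.rpow_sub hρ,
    Real.rpow_natCast]
  set A := ‖∏ k ∈ Finset.range n, ((k : ℂ) - ((1 / 2 : ℝ) : ℂ))‖ with hA
  have h2 := quarter_le_prod_sq n hn
  rw [← hA] at h2
  have h3 : 1 / 4 * (n : ℝ) ^ (-(3 / 2) : ℝ) ≤ A / n ! := by
    refine le_of_sq_le_sq ?_ (by positivity)
    have e : ((n : ℝ) ^ (-(3 / 2) : ℝ)) ^ 2 = ((n : ℝ) ^ 3)⁻¹ := by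
      rw [← Real.rpow_natCast, ← Real.rpow_mul (by positivity), ← Real.rpow_natCast,
        ← Real.rpow_neg (by positivity)]
      norm_num
    rw [mul_pow, e, ← div_eq_mul_inv, div_le_iff₀ (by positivity)]
    have : (A / n !) ^ 2 * (n * (2 * n - 1) ^ 2) ≤ (A / n !) ^ 2 * (4 * n ^ 3) := by
      refine mul_le_mul_of_nonneg_left ?_ (sq_nonneg _)
      nlinarith
    linarith
  calc _ = ρ ^ (1 / 2 : ℝ) * (1 / 4 * (n : ℝ) ^ (-(3 / 2) : ℝ)) := by ring
    _ ≤ ρ ^ (1 / 2 : ℝ) * (A / n !) := by gcongr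
    _ = _ := by field_simp

/-! ### Geometry of the Δ-domain -/

/-- Cosine decreases on [0, π], so the angular condition becomes a linear inequality on the real
part. -/
theorem mem_deltaDomain_of_re_lt {ρ R θ : ℝ} {w : ℂ} (hθ : θ < Real.pi / 2) (hw : ‖w‖ < R) (hne : w ≠ ρ)
    (hre : (w - ρ).re < Real.cos θ * ‖w - ρ‖) : w ∈ deltaDomain ρ R θ := by
  refine ⟨hw, hne, ?_⟩
  by_contra! h
  have h0 : w - ρ ≠ 0 := sub_ne_zero.mpr hne
  have h1 := Complex.cos_arg h0
  have h2 := Real.cos_le_cos_of_nonneg_of_le_pi (abs_nonneg _) (by linarith [Real.pi_pos]) h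
  rw [Real.cos_abs, h1, le_div_iff₀ (norm_pos_iff.mpr h0)] at h2
  linarith

theorem re_sub_neg_of_norm_le {ρ : ℝ} {z : ℂ} (hz : ‖z‖ ≤ ρ) (hne : z ≠ ρ) : (z - ρ).re < 0 := by
  have h1 := Complex.re_le_norm z
  have h2 : z.re ≠ ρ := by
    intro h
    refine hne (Complex.ext (by simpa using h) ?_)
    have h3 := Complex.sq_norm z
    rw [Complex.normSq_apply] at h3
    have h4 : ‖z‖ ^ 2 ≤ ρ ^ 2 := by gcongr
    simp only [Complex.ofReal_im]
    rw [h] at h3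
    nlinarith
  have h3 : z.re < ρ := lt_of_le_of_ne (h1.trans hz) h2
  simpa using h3

theorem mem_deltaDomain_of_norm_le {ρ R θ : ℝ} {z : ℂ} (hθ : 0 < θ) (hθ' : θ < Real.pi / 2)
    (hR : ρ < R) (hz : ‖z‖ ≤ ρ) (hne : z ≠ ρ) : z ∈ deltaDomain ρ R θ := by
  refine mem_deltaDomain_of_re_lt hθ' (by linarith) hne ?_
  have h1 := re_sub_neg_of_norm_le hz hne
  have h2 : 0 < Real.cos θ := Real.cos_pos_of_mem_Ioo ⟨by linarith, hθ'⟩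
  have h3 := norm_nonneg (z - ρ)
  nlinarith

-- Provides room for Cauchy estimates at scale |z - ρ|: Re (z - ρ) < 0, so a move by cos θ / 4 · |z
-- - ρ| leaves the real part below cos θ · |w - ρ|.
open Metric in
theorem closedBall_subset_deltaDomain {ρ R θ : ℝ} (hθ : 0 < θ) (hθ' : θ < Real.pi / 2) {z : ℂ}
    (hz : ‖z‖ ≤ ρ) (hne : z ≠ ρ) :
    closedBall z (Real.cos θ / 4 * ‖z - ρ‖) ∩ ball (ρ : ℂ) (R - ρ) ⊆ deltaDomain ρ R θ := by
  rintro w ⟨hw, hwR⟩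
  have h1 := re_sub_neg_of_norm_le hz hne
  have h2 : 0 < Real.cos θ := Real.cos_pos_of_mem_Ioo ⟨by linarith, hθ'⟩
  have h2' := Real.cos_le_one θ
  have h3 : 0 < ‖z - ρ‖ := norm_pos_iff.mpr (sub_ne_zero.mpr hne)
  rw [mem_closedBall, dist_eq_norm] at hw
  have h4 : (w - ρ).re ≤ (z - ρ).re + ‖w - z‖ := by
    have := Complex.re_le_norm (w - z)
    simp at this ⊢
    linarith
  have h5 : ‖z - ρ‖ ≤ ‖w - ρ‖ + ‖w - z‖ := by
    have := norm_sub_le (w - ρ) (w - z)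
    simpa using this
  have h6 : 3 / 4 * ‖z - ρ‖ ≤ ‖w - ρ‖ := by nlinarith
  refine mem_deltaDomain_of_re_lt hθ' ?_ ?_ ?_
  · rw [mem_ball, dist_eq_norm] at hwR
    have := norm_le_norm_add_norm_sub (ρ : ℂ) w
    have hρ : 0 ≤ ρ := (norm_nonneg z).trans hz
    rw [Complex.norm_real, Real.norm_of_nonneg hρ, norm_sub_rev] at this
    linarith [this, norm_sub_rev w (ρ : ℂ)]
  · rintro rfl
    simp at h6
    linarith
  · nlinarith

theorem sub_mem_slitPlane_of_mem_deltaDomain {ρ R θ : ℝ} (hθ : 0 < θ) {z : ℂ}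
    (hz : z ∈ deltaDomain ρ R θ) : (ρ : ℂ) - z ∈ Complex.slitPlane := by
  rw [Complex.mem_slitPlane_iff]
  by_contra! h
  have h1 : Complex.arg (z - ρ) = 0 := by
    rw [Complex.arg_eq_zero_iff]
    have := h.1
    have := h.2
    simp at *
    constructor <;> linarith
  have := hz.2.2
  rw [h1, abs_zero] at this
  linarith

/-! ### Singular expansion: derivatives, coefficients, radial limit -/

open Metric in
/-- Differentiating the error term `o(|ρ - z| ^ (1/2))` of a singular expansion three times. -/
theorem exists_norm_iteratedDeriv_three_le {ρ R θ : ℝ} {f F : ℂ → ℂ} {c : ℂ} (hρ : 0 < ρ)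
    (hR : ρ < R) (hθ : 0 < θ) (hθ' : θ < Real.pi / 2)
    (hf : AnalyticOnNhd ℂ f (deltaDomain ρ R θ)) (hF : AnalyticAt ℂ F ρ)
    (hfF : (fun z : ℂ => f z - (F z + c * ((ρ : ℂ) - z) ^ ((1 / 2 : ℝ) : ℂ)))
      =o[𝓝[deltaDomain ρ R θ] (ρ : ℂ)] fun z : ℂ => ((ρ : ℂ) - z) ^ ((1 / 2 : ℝ) : ℂ))
    {ε : ℝ} (hε : 0 < ε) :
    ∃ M : ℝ, ∀ z ∈ ball (0 : ℂ) ρ,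
      ‖iteratedDeriv 3 (fun z => f z - c * ((ρ : ℂ) - z) ^ ((1 / 2 : ℝ) : ℂ)) z‖ ≤
        ε * ‖(ρ : ℂ) - z‖ ^ (-(5 / 2) : ℝ) + M := by
  set s : ℂ → ℂ := fun z => ((ρ : ℂ) - z) ^ ((1 / 2 : ℝ) : ℂ) with hs
  set g : ℂ → ℂ := fun z => f z - c * s z with hg
  have hcos : 0 < Real.cos θ := Real.cos_pos_of_mem_Ioo ⟨by linarith, hθ'⟩
  have hcos1 := Real.cos_le_one θ
  have hsan : AnalyticOnNhd ℂ s (deltaDomain ρ R θ) := fun z hz =>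
    (analyticAt_const.sub analyticAt_id).cpow analyticAt_const
      (sub_mem_slitPlane_of_mem_deltaDomain hθ hz)
  have hgan : AnalyticOnNhd ℂ g (deltaDomain ρ R θ) := fun z hz =>
    (hf z hz).sub (analyticAt_const.mul (hsan z hz))
  set κ : ℝ := Real.cos θ / 4 with hκ
  have hκ0 : 0 < κ := by positivity
  -- Cauchy's estimate at radius κt costs 3!/(κt)³, and |ρ - w|^(1/2) ≤ (4t)^(1/2) costs a factor 2;
  -- 12 = 3! · 2.
  set ε' : ℝ := ε * κ ^ 3 / 12 with hε'
  have hε'0 : 0 < ε' := by positivity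
  have hev := hfF.def hε'0
  rw [eventually_nhdsWithin_iff] at hev
  have hFev := hF.eventually_analyticAt
  have hF3 : AnalyticAt ℂ (iteratedDeriv 3 F) ρ := by
    rw [iteratedDeriv_eq_iterate]; exact hF.iterated_deriv 3
  have hFb : ∀ᶠ z in 𝓝 (ρ : ℂ), ‖iteratedDeriv 3 F z‖ < ‖iteratedDeriv 3 F ρ‖ + 1 :=
    hF3.continuousAt.norm.eventually_lt_const (lt_add_one _)
  obtain ⟨δ₀, hδ₀, hball⟩ := Metric.eventually_nhds_iff_ball.mp (hev.and (hFev.and hFb))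
  set δ : ℝ := min δ₀ (R - ρ) with hδ
  have hδ0 : 0 < δ := lt_min hδ₀ (by linarith)
  -- the part of the closed disk away from `ρ`
  set S : Set ℂ := closedBall 0 ρ \ ball (ρ : ℂ) (δ / 2) with hS
  have hScomp : IsCompact S := (isCompact_closedBall 0 ρ).diff isOpen_ball
  have hSΔ : ∀ z ∈ S, z ∈ deltaDomain ρ R θ := by
    rintro z ⟨hz1, hz2⟩
    refine mem_deltaDomain_of_norm_le hθ hθ' hR (by simpa using hz1) ?_
    rintro rfl
    exact hz2 (mem_ball_self (by positivity))
  have hg3 : ∀ z ∈ deltaDomain ρ R θ, AnalyticAt ℂ (iteratedDeriv 3 g) z := fun z hz => by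
    rw [iteratedDeriv_eq_iterate]; exact (hgan z hz).iterated_deriv 3
  obtain ⟨M, hM⟩ := hScomp.exists_bound_of_continuousOn
    (fun z hz => (hg3 z (hSΔ z hz)).continuousAt.continuousWithinAt)
  refine ⟨max M (‖iteratedDeriv 3 F ρ‖ + 1), fun z hz => ?_⟩
  rw [mem_ball_zero_iff] at hz
  have hzρ : z ≠ ρ := by
    rintro rfl
    rw [Complex.norm_real, Real.norm_of_nonneg hρ.le] at hz
    exact lt_irrefl _ hz
  set t : ℝ := ‖(ρ : ℂ) - z‖ with ht
  have ht' : ‖z - ρ‖ = t := norm_sub_rev _ _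
  have ht0 : 0 < t := norm_pos_iff.mpr (sub_ne_zero.mpr hzρ.symm)
  by_cases hnear : z ∈ ball (ρ : ℂ) (δ / 2)
  swap
  · have := hM z ⟨by simpa using hz.le, hnear⟩
    have h2 : 0 ≤ ε * t ^ (-(5 / 2) : ℝ) := by positivity
    linarith [le_max_left M (‖iteratedDeriv 3 F ρ‖ + 1)]
  have htδ : t < δ / 2 := by rwa [mem_ball, dist_eq_norm, ht'] at hnear
  have hδR : δ ≤ R - ρ := min_le_right _ _
  have hcb : closedBall z (κ * t) ⊆ ball (ρ : ℂ) δ := by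
    intro w hw
    rw [mem_closedBall] at hw
    rw [mem_ball]
    have := dist_triangle w z ρ
    rw [dist_eq_norm z, ht'] at this
    nlinarith
  have hcbΔ : closedBall z (κ * t) ⊆ deltaDomain ρ R θ := fun w hw =>
    closedBall_subset_deltaDomain hθ hθ' hz.le hzρ
      ⟨by rw [ht']; exact hw, ball_subset_ball hδR (hcb hw)⟩
  have hb := fun w (hw : w ∈ closedBall z (κ * t)) =>
    hball w (ball_subset_ball (min_le_left _ _) (hcb hw))
  set h : ℂ → ℂ := fun z => f z - (F z + c * s z) with hh
  have hhan : ∀ w ∈ closedBall z (κ * t), AnalyticAt ℂ h w := fun w hw =>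
    (hf w (hcbΔ hw)).sub ((hb w hw).2.1.add (analyticAt_const.mul (hsan w (hcbΔ hw))))
  have hzc : z ∈ closedBall z (κ * t) := mem_closedBall_self (by positivity)
  -- Near ρ only the error term h needs Cauchy's estimate; the third derivative of F is bounded
  -- there.
  have hgh : g = fun w => h w + F w := by
    funext w; simp only [hg, hh]; ring
  have hsum : iteratedDeriv 3 g z = iteratedDeriv 3 h z + iteratedDeriv 3 F z := by
    rw [hgh]
    exact iteratedDeriv_fun_add (hhan z hzc).contDiffAt (hb z hzc).2.1.contDiffAt
  have hC : ∀ w ∈ sphere z (κ * t), ‖h w‖ ≤ ε' * (2 * t ^ (1 / 2 : ℝ)) := by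
    intro w hw
    have hw' := sphere_subset_closedBall hw
    refine ((hb w hw').1 (hcbΔ hw')).trans ?_
    rw [Complex.norm_cpow_real]
    have h4 : ‖(ρ : ℂ) - w‖ ≤ 4 * t := by
      have := dist_triangle w z ρ
      rw [dist_eq_norm z, ht', mem_sphere.mp hw, dist_comm, dist_eq_norm] at this
      nlinarith
    gcongr
    calc ‖(ρ : ℂ) - w‖ ^ (1 / 2 : ℝ) ≤ (4 * t) ^ (1 / 2 : ℝ) := by gcongr
      _ = 2 * t ^ (1 / 2 : ℝ) := by
        rw [Real.mul_rpow (by norm_num) ht0.le, ← Real.sqrt_eq_rpow,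
          show (4 : ℝ) = 2 ^ 2 by norm_num, Real.sqrt_sq (by norm_num)]
  have hdc : DiffContOnCl ℂ h (ball z (κ * t)) := by
    refine DifferentiableOn.diffContOnCl fun w hw => ?_
    exact (hhan w (closure_ball_subset_closedBall hw)).differentiableAt.differentiableWithinAt
  have hcauchy := Complex.norm_iteratedDeriv_le_of_forall_mem_sphere_norm_le 3
    (mul_pos hκ0 ht0) hdc hC
  have hexp : ((3 ! : ℕ) : ℝ) * (ε' * (2 * t ^ (1 / 2 : ℝ))) / (κ * t) ^ 3 =
      ε * t ^ (-(5 / 2) : ℝ) := by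
    have e1 : t ^ (-(5 / 2) : ℝ) * t ^ 3 = t ^ (1 / 2 : ℝ) := by
      rw [← Real.rpow_natCast, ← Real.rpow_add ht0]; norm_num
    rw [div_eq_iff (by positivity), ← e1, hε']
    norm_num [Nat.factorial]
    ring
  rw [hexp] at hcauchy
  rw [hsum]
  refine (norm_add_le _ _).trans (add_le_add hcauchy ?_)
  exact (hb z hzc).2.2.le.trans (le_max_right _ _)

open Metric in
/-- Lower bound for the Taylor coefficients of a function with a square-root singularity. -/
theorem exists_le_abs_coeff {ρ R θ : ℝ} {f F : ℂ → ℂ} {c : ℂ} {a : ℕ → ℝ} (hρ : 0 < ρ)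
    (hR : ρ < R) (hθ : 0 < θ) (hθ' : θ < Real.pi / 2)
    (hf : AnalyticOnNhd ℂ f (deltaDomain ρ R θ)) (hF : AnalyticAt ℂ F ρ) (hc : c ≠ 0)
    (hfF : (fun z : ℂ => f z - (F z + c * ((ρ : ℂ) - z) ^ ((1 / 2 : ℝ) : ℂ)))
      =o[𝓝[deltaDomain ρ R θ] (ρ : ℂ)] fun z : ℂ => ((ρ : ℂ) - z) ^ ((1 / 2 : ℝ) : ℂ))
    (ha : ∀ z : ℂ, ‖z‖ < ρ → HasSum (fun n => (a n : ℂ) * z ^ n) (f z)) :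
    ∃ δ : ℝ, 0 < δ ∧ ∀ᶠ n : ℕ in atTop, δ * (n : ℝ) ^ (-(3 / 2) : ℝ) ≤ |a n| * ρ ^ n := by
  set s : ℂ → ℂ := fun z => ((ρ : ℂ) - z) ^ ((1 / 2 : ℝ) : ℂ) with hs
  set g : ℂ → ℂ := fun z => f z - c * s z with hg
  have hmem : ∀ z ∈ ball (0 : ℂ) ρ, z ∈ deltaDomain ρ R θ := by
    intro z hz
    rw [mem_ball_zero_iff] at hz
    refine mem_deltaDomain_of_norm_le hθ hθ' hR hz.le ?_
    rintro rfl
    rw [Complex.norm_real, Real.norm_of_nonneg hρ.le] at hz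
    exact lt_irrefl _ hz
  have hsan : ∀ z ∈ ball (0 : ℂ) ρ, AnalyticAt ℂ s z := fun z hz =>
    (analyticAt_const.sub analyticAt_id).cpow analyticAt_const
      (sub_mem_slitPlane_of_norm_lt (by simpa using hz))
  have hgan : ∀ z ∈ ball (0 : ℂ) ρ, AnalyticAt ℂ g z := fun z hz =>
    (hf z (hmem z hz)).sub (analyticAt_const.mul (hsan z hz))
  have hg3 : DifferentiableOn ℂ (iteratedDeriv 3 g) (ball 0 ρ) := fun z hz => by
    rw [iteratedDeriv_eq_iterate]
    exact ((hgan z hz).iterated_deriv 3).differentiableAt.differentiableWithinAt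
  have h0 : (0 : ℂ) ∈ ball (0 : ℂ) ρ := mem_ball_self hρ
  have hc0 : 0 < ‖c‖ := norm_pos_iff.mpr hc
  -- Half of the lower bound for the coefficients of c · s; the other half pays for those of g.
  set δ : ℝ := ‖c‖ * ρ ^ (1 / 2 : ℝ) / 8 with hδ
  have hδ0 : 0 < δ := by positivity
  have hcoef : ∀ n, iteratedDeriv n f 0 / n ! = a n := by
    intro n
    have h1 : HasFPowerSeriesAt f (FormalMultilinearSeries.ofScalars ℂ fun n => (a n : ℂ)) 0 := by
      rw [hasFPowerSeriesAt_iff]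
      filter_upwards [ball_mem_nhds (0 : ℂ) hρ] with z hz
      simpa [mul_comm] using ha z (by simpa using hz)
    have h2 := h1.eq_formalMultilinearSeries (hf 0 (hmem 0 h0)).hasFPowerSeriesAt
    have h3 := congrArg (fun p => FormalMultilinearSeries.coeff p n) h2
    simpa [FormalMultilinearSeries.coeff_ofScalars] using h3.symm
  refine ⟨δ, hδ0, ?_⟩
  filter_upwards [eventually_norm_coeff_le hρ hg3
    (fun ε hε => exists_norm_iteratedDeriv_three_le hρ hR hθ hθ' hf hF hfF hε) hδ0,
    eventually_ge_atTop 1] with n hn hn1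
  have hlow := le_norm_coeff_sqrt hρ n hn1
  have hsub : iteratedDeriv n g 0 = iteratedDeriv n f 0 - c * iteratedDeriv n s 0 := by
    rw [hg, iteratedDeriv_fun_sub (f := f) (g := fun z => c * s z) (hf 0 (hmem 0 h0)).contDiffAt
      (analyticAt_const.mul (hsan 0 h0)).contDiffAt,
      iteratedDeriv_const_mul c (hsan 0 h0).contDiffAt]
  have htri : ‖c‖ * (‖iteratedDeriv n s 0‖ / n ! * ρ ^ n) ≤
      |a n| * ρ ^ n + ‖iteratedDeriv n g 0‖ / n ! * ρ ^ n := by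
    have e : c * iteratedDeriv n s 0 / n ! = a n - iteratedDeriv n g 0 / n ! := by
      rw [hsub, ← hcoef n]; ring
    have e2 := norm_sub_le (a n : ℂ) (iteratedDeriv n g 0 / n !)
    rw [← e, norm_div, norm_mul, norm_div, Complex.norm_natCast, Complex.norm_real,
      Real.norm_eq_abs] at e2
    calc _ = ‖c‖ * ‖iteratedDeriv n s 0‖ / n ! * ρ ^ n := by ring
      _ ≤ (|a n| + ‖iteratedDeriv n g 0‖ / n !) * ρ ^ n := by gcongr
      _ = _ := by ring
  have := mul_le_mul_of_nonneg_left hlow hc0.le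
  have e3 : ‖c‖ * (ρ ^ (1 / 2 : ℝ) / 4 * (n : ℝ) ^ (-(3 / 2) : ℝ)) =
      2 * (δ * (n : ℝ) ^ (-(3 / 2) : ℝ)) := by rw [hδ]; ring
  rw [e3] at this
  linarith

theorem exists_norm_sub_le_rpow_half {ρ R θ : ℝ} {f F : ℂ → ℂ} {c : ℂ} (hρ : 0 < ρ)
    (hR : ρ < R) (hθ : 0 < θ) (hθ' : θ < Real.pi / 2) (hF : AnalyticAt ℂ F ρ)
    (hfF : (fun z : ℂ => f z - (F z + c * ((ρ : ℂ) - z) ^ ((1 / 2 : ℝ) : ℂ)))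
      =o[𝓝[deltaDomain ρ R θ] (ρ : ℂ)] fun z : ℂ => ((ρ : ℂ) - z) ^ ((1 / 2 : ℝ) : ℂ)) :
    ∃ K : ℝ, 0 < K ∧ ∀ᶠ x : ℝ in 𝓝[<] ρ, ‖f x - F ρ‖ ≤ K * (ρ - x) ^ (1 / 2 : ℝ) := by
  have h1 := hfF.def one_pos
  obtain ⟨L, hL⟩ := hF.differentiableAt.isBigO_sub.bound
  have hmap : Tendsto (fun x : ℝ => (x : ℂ)) (𝓝[<] ρ) (𝓝[deltaDomain ρ R θ] (ρ : ℂ)) := by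
    refine tendsto_nhdsWithin_iff.mpr
      ⟨Complex.continuous_ofReal.continuousAt.tendsto.mono_left nhdsWithin_le_nhds, ?_⟩
    filter_upwards [Ioo_mem_nhdsLT hρ] with x hx
    refine mem_deltaDomain_of_norm_le hθ hθ' hR ?_ ?_
    · rw [Complex.norm_real, Real.norm_of_nonneg hx.1.le]; exact hx.2.le
    · exact_mod_cast hx.2.ne
  refine ⟨1 + |L| + ‖c‖, by positivity, ?_⟩
  -- Within distance 1 of ρ, the linear variation of F is dominated by the square root.
  have hlt : max 0 (ρ - 1) < ρ := max_lt hρ (by linarith)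
  filter_upwards [hmap.eventually h1, (hmap.mono_right nhdsWithin_le_nhds).eventually hL,
    Ioo_mem_nhdsLT hlt] with x hx1 hx2 hx3
  have hx : ρ - x ≤ 1 := by linarith [le_max_right 0 (ρ - 1), hx3.1]
  have hx0 : 0 < ρ - x := by linarith [hx3.2]
  have en : ‖(ρ : ℂ) - x‖ = ρ - x := by
    rw [← Complex.ofReal_sub, Complex.norm_real, Real.norm_of_nonneg hx0.le]
  rw [Complex.norm_cpow_real, en, one_mul] at hx1
  rw [norm_sub_rev (x : ℂ), en] at hx2
  have hle : ρ - x ≤ (ρ - x) ^ (1 / 2 : ℝ) := by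
    simpa using Real.rpow_le_rpow_of_exponent_ge hx0 hx (by norm_num : (1 / 2 : ℝ) ≤ 1)
  have hs : ‖c * ((ρ : ℂ) - x) ^ ((1 / 2 : ℝ) : ℂ)‖ = ‖c‖ * (ρ - x) ^ (1 / 2 : ℝ) := by
    rw [norm_mul, Complex.norm_cpow_real, en]
  have e : f x - F ρ = (f x - (F x + c * ((ρ : ℂ) - x) ^ ((1 / 2 : ℝ) : ℂ))) + (F x - F ρ) +
      c * ((ρ : ℂ) - x) ^ ((1 / 2 : ℝ) : ℂ) := by ring
  rw [e]
  refine (norm_add₃_le).trans ?_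
  rw [hs]
  have : L * (ρ - x) ≤ |L| * (ρ - x) ^ (1 / 2 : ℝ) := by
    calc L * (ρ - x) ≤ |L| * (ρ - x) := by gcongr; exact le_abs_self L
      _ ≤ _ := by gcongr
  linarith

/-! ### Generating function and Boltzmann law -/

namespace MixedClass
variable (C : MixedClass.{u})

theorem term_eq_pow_mul {𝕜 : Type*} [RCLike 𝕜] (x y : 𝕜) (γ : C.Object) :
    C.term x y γ = C.term 1 y γ * x ^ C.lsize γ := by
  simp only [term]; ring

theorem term_nonneg {x y : ℝ} (hx : 0 ≤ x) (hy : 0 ≤ y) (γ : C.Object) : 0 ≤ C.term x y γ := by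
  unfold term; positivity

theorem term_mono {x x' y : ℝ} (hx : 0 ≤ x) (hxx' : x ≤ x') (hy : 0 ≤ y) (γ : C.Object) :
    C.term x y γ ≤ C.term x' y γ := by
  unfold term; gcongr

theorem ofReal_term (x y : ℝ) (γ : C.Object) :
    ((C.term x y γ : ℝ) : ℂ) = C.term (x : ℂ) (y : ℂ) γ := by
  simp [term]

theorem norm_term (z : ℂ) {y : ℝ} (hy : 0 ≤ y) (γ : C.Object) :
    ‖C.term z (y : ℂ) γ‖ = C.term ‖z‖ y γ := by
  simp [term, abs_of_nonneg hy]

theorem ofReal_genFun (x y : ℝ) : ((C.genFun x y : ℝ) : ℂ) = C.genFun (x : ℂ) (y : ℂ) := by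
  rw [genFun, Complex.ofReal_tsum, genFun]
  simp_rw [ofReal_term]

theorem summable_term_of_lt_radius {x y : ℝ} (hx : 0 ≤ x) (hy : 0 ≤ y)
    (h : ENNReal.ofReal x < C.radius y) : Summable fun γ => C.term x y γ := by
  rw [radius, lt_iSup_iff] at h
  obtain ⟨r, hr⟩ := h
  rw [lt_iSup_iff] at hr
  obtain ⟨hs, hr⟩ := hr
  have hxr : x ≤ r := by
    rw [← ENNReal.ofReal_coe_nnreal] at hr
    exact ((ENNReal.ofReal_lt_ofReal_iff_of_nonneg hx).mp hr).le
  exact hs.of_nonneg_of_le (C.term_nonneg hx hy) (C.term_mono hx hxr hy)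

/-- The coefficient of `x ^ k` in `C(x, y)`. -/
noncomputable def coeff (y : ℝ) (k : ℕ) : ℝ :=
  ∑' γ : {γ : C.Object // C.lsize γ = k}, C.term 1 y γ

theorem coeff_nonneg {y : ℝ} (hy : 0 ≤ y) (k : ℕ) : 0 ≤ C.coeff y k :=
  tsum_nonneg fun γ => C.term_nonneg zero_le_one hy γ

variable {C}

theorem IsSingularPoint.summable_term {x₀ y₀ x : ℝ} (h : C.IsSingularPoint x₀ y₀) (hx : 0 ≤ x)
    (hx₀ : x < x₀) : Summable fun γ => C.term x y₀ γ := by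
  refine C.summable_term_of_lt_radius hx h.2.1.le ?_
  rw [h.2.2]
  exact (ENNReal.ofReal_lt_ofReal_iff h.1).mpr hx₀

theorem IsSingularPoint.admissible {x₀ y₀ x : ℝ} (h : C.IsSingularPoint x₀ y₀) (hx : 0 < x)
    (hx₀ : x < x₀) : C.Admissible x y₀ :=
  ⟨hx, h.2.1, by rw [h.2.2]; exact (ENNReal.ofReal_lt_ofReal_iff h.1).mpr hx₀⟩

theorem IsSingularPoint.hasSum_coeff {x₀ y₀ : ℝ} (h : C.IsSingularPoint x₀ y₀) (k : ℕ) :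
    HasSum (fun γ : {γ : C.Object // C.lsize γ = k} => C.term 1 y₀ γ) (C.coeff y₀ k) := by
  refine Summable.hasSum ?_
  -- Any point of (0, x₀) would do; dividing by its k-th power gives summability at x = 1 on the
  -- objects of size k.
  have h1 := h.summable_term (x := x₀ / 2) (by linarith [h.1]) (by linarith [h.1])
  have h2 : Summable fun γ : {γ : C.Object // C.lsize γ = k} => C.term (x₀ / 2) y₀ γ :=
    h1.comp_injective Subtype.val_injective
  have h3 := h2.mul_right ((x₀ / 2) ^ k)⁻¹
  refine h3.congr fun γ => ?_
  have : (x₀ / 2) ^ k ≠ 0 := pow_ne_zero _ (by linarith [h.1])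
  rw [C.term_eq_pow_mul (x₀ / 2), γ.2, mul_inv_cancel_right₀ this]

theorem IsSingularPoint.hasSum_genFun {x₀ y₀ : ℝ} (h : C.IsSingularPoint x₀ y₀) {z : ℂ}
    (hz : ‖z‖ < x₀) : HasSum (fun k => (C.coeff y₀ k : ℂ) * z ^ k) (C.genFun z (y₀ : ℂ)) := by
  have h1 : Summable fun γ => C.term z (y₀ : ℂ) γ := by
    refine Summable.of_norm ?_
    simp_rw [C.norm_term z h.2.1.le]
    exact h.summable_term (norm_nonneg z) hz
  have h2 := (Equiv.sigmaFiberEquiv C.lsize).hasSum_iff.mpr h1.hasSum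
  refine HasSum.sigma h2 fun k => ?_
  convert! (Complex.hasSum_ofReal.mpr (h.hasSum_coeff k)).mul_right (z ^ k) using 1
  funext γ
  simp only [Function.comp_apply, Equiv.sigmaFiberEquiv_apply]
  rw [C.term_eq_pow_mul z, γ.2, C.ofReal_term, Complex.ofReal_one]

variable {Γ : ℝ → ℝ → PMF C.Object}

theorem IsBoltzmannSampler.probSize_singleton (hΓ : C.IsBoltzmannSampler Γ) {x₀ y₀ x : ℝ}
    (h : C.IsSingularPoint x₀ y₀) (hx : 0 < x) (hx₀ : x < x₀) (k : ℕ) :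
    probSize (Γ x y₀) {k} = ENNReal.ofReal (C.coeff y₀ k * x ^ k / C.genFun x y₀) := by
  have hG : 0 ≤ C.genFun x y₀ := tsum_nonneg fun γ => C.term_nonneg hx.le h.2.1.le γ
  have h1 : HasSum (fun γ : {γ : C.Object // C.lsize γ = k} => C.term x y₀ γ / C.genFun x y₀)
      (C.coeff y₀ k * x ^ k / C.genFun x y₀) := by
    rw [mul_div_assoc]
    convert! (h.hasSum_coeff k).mul_right (x ^ k / C.genFun x y₀) using 1
    funext γ
    rw [C.term_eq_pow_mul x, γ.2, mul_div_assoc]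
  rw [probSize, PMF.toOuterMeasure_apply, ← tsum_subtype, ← h1.tsum_eq,
    ENNReal.ofReal_tsum_of_nonneg _ h1.summable]
  · exact tsum_congr fun γ => hΓ x y₀ (h.admissible hx hx₀) γ
  · exact fun γ => div_nonneg (C.term_nonneg hx.le h.2.1.le γ) hG

theorem sum_probSize_singleton_le (μ : PMF C.Object) (F : Finset ℕ) (S : Set ℕ)
    (hF : (F : Set ℕ) ⊆ S) : ∑ k ∈ F, probSize μ {k} ≤ probSize μ S := by
  simp only [probSize, PMF.toOuterMeasure_apply]
  rw [← Summable.tsum_finsetSum fun _ _ => ENNReal.summable]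
  refine ENNReal.tsum_le_tsum fun γ => ?_
  simp only [Set.indicator_apply, Set.mem_ofPred_eq, Set.mem_singleton_iff]
  rw [Finset.sum_ite_eq]
  by_cases h1 : C.lsize γ ∈ F
  · have h2 : C.lsize γ ∈ S := hF h1
    simp [h1, h2]
  · simp [h1]

/-- Convexity of x ↦ x^k, in the form of Bernoulli's inequality for (x'/x)^k. -/
theorem term_sub_mul_lsize_le {x x' y : ℝ} (hx : 0 < x) (hxx' : x < x') (hy : 0 ≤ y)
    (γ : C.Object) :
    C.term x y γ * C.lsize γ ≤ (C.term x' y γ - C.term x y γ) * (x / (x' - x)) := by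
  rw [C.term_eq_pow_mul x, C.term_eq_pow_mul x', ← mul_sub, mul_assoc, mul_assoc]
  refine mul_le_mul_of_nonneg_left ?_ (C.term_nonneg zero_le_one hy γ)
  rw [mul_div_assoc', le_div_iff₀ (by linarith)]
  set k := C.lsize γ
  have h1 : (k : ℝ) * (x' / x - 1) ≤ (x' / x) ^ k - 1 := by
    have := one_add_mul_le_pow (a := x' / x - 1) (by
      have : 0 < x' / x := div_pos (hx.trans hxx') hx
      linarith) k
    rw [add_sub_cancel] at this
    linarith
  calc x ^ k * k * (x' - x) = x ^ k * x * (k * (x' / x - 1)) := by field_simp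
    _ ≤ x ^ k * x * ((x' / x) ^ k - 1) := by gcongr
    _ = (x' ^ k - x ^ k) * x := by rw [div_pow]; field_simp

/-- The mean is x C'(x)/C(x); a secant slope to the right replaces the derivative, so the expansion
of C never has to be differentiated here. -/
theorem IsBoltzmannSampler.expectedSize_le (hΓ : C.IsBoltzmannSampler Γ) {x₀ y₀ x x' : ℝ}
    (h : C.IsSingularPoint x₀ y₀) (hx : 0 < x) (hxx' : x < x') (hx₀ : x' < x₀) :
    expectedSize (Γ x y₀) ≤ ENNReal.ofReal
      ((C.genFun x' y₀ - C.genFun x y₀) * (x / (x' - x)) / C.genFun x y₀) := by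
  have hy := h.2.1.le
  have hG : 0 ≤ C.genFun x y₀ := tsum_nonneg fun γ => C.term_nonneg hx.le hy γ
  have hs : HasSum (fun γ => (C.term x' y₀ γ - C.term x y₀ γ) * (x / (x' - x)) / C.genFun x y₀)
      ((C.genFun x' y₀ - C.genFun x y₀) * (x / (x' - x)) / C.genFun x y₀) :=
    ((((h.summable_term (hx.trans hxx').le hx₀).hasSum).sub
      (h.summable_term hx.le (hxx'.trans hx₀)).hasSum).mul_right _).div_const _
  have h0 : ∀ γ, 0 ≤ (C.term x' y₀ γ - C.term x y₀ γ) * (x / (x' - x)) / C.genFun x y₀ := by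
    intro γ
    have := C.term_mono hx.le hxx'.le hy γ
    have h1 : 0 < x' - x := by linarith
    have h2 : 0 ≤ C.term x' y₀ γ - C.term x y₀ γ := by linarith
    positivity
  rw [expectedSize, ← hs.tsum_eq, ENNReal.ofReal_tsum_of_nonneg h0 hs.summable]
  refine ENNReal.tsum_le_tsum fun γ => ?_
  rw [hΓ x y₀ (h.admissible hx (hxx'.trans hx₀)), ← ENNReal.ofReal_natCast,
    ← ENNReal.ofReal_mul (div_nonneg (C.term_nonneg hx.le hy γ) hG)]
  refine ENNReal.ofReal_le_ofReal ?_
  rw [div_mul_eq_mul_div]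
  exact div_le_div_of_nonneg_right (term_sub_mul_lsize_le hx hxx' hy γ) hG

/-- The analytic consequences of a square-root singularity: a lower bound for the coefficients and
the behaviour of `C(x, y₀)` as `x` tends to `x₀`. -/
theorem HasSquareRootSingularities.bounds (hC : C.HasSquareRootSingularities) {x₀ y₀ : ℝ}
    (h : C.IsSingularPoint x₀ y₀) :
    (∃ δ : ℝ, 0 < δ ∧ ∀ᶠ n : ℕ in atTop,
      δ * (n : ℝ) ^ (-(3 / 2) : ℝ) ≤ C.coeff y₀ n * x₀ ^ n) ∧
    ∃ L K : ℝ, 0 < K ∧ ∀ᶠ x : ℝ in 𝓝[<] x₀,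
      |C.genFun x y₀ - L| ≤ K * (x₀ - x) ^ (1 / 2 : ℝ) := by
  obtain ⟨R, θ, f, p, q, c, hR, hθ, hθ', hf, hfC, hq, hc, hfF⟩ := hC.2 x₀ y₀ h
  have hx₀ := h.1
  have hF : AnalyticAt ℂ (fun z => p.eval z / q.eval z) (x₀ : ℂ) := by
    refine AnalyticAt.div ?_ ?_ (hq _ ?_)
    · exact (Polynomial.differentiable p).analyticAt _
    · exact (Polynomial.differentiable q).analyticAt _
    · rw [Complex.norm_real, Real.norm_of_nonneg hx₀.le]
  constructor
  · obtain ⟨δ, hδ, hev⟩ := exists_le_abs_coeff (a := C.coeff y₀) hx₀ hR hθ hθ' hf hF hc hfF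
      fun z hz => by rw [hfC z hz]; exact h.hasSum_genFun hz
    refine ⟨δ, hδ, hev.mono fun n hn => ?_⟩
    rwa [abs_of_nonneg (C.coeff_nonneg h.2.1.le n)] at hn
  · obtain ⟨K, hK, hev⟩ := exists_norm_sub_le_rpow_half hx₀ hR hθ hθ' hF hfF
    refine ⟨(p.eval (x₀ : ℂ) / q.eval (x₀ : ℂ)).re, K, hK, ?_⟩
    filter_upwards [hev, Ioo_mem_nhdsLT hx₀] with x hx hx'
    refine le_trans ?_ hx
    rw [hfC x (by rw [Complex.norm_real, Real.norm_of_nonneg hx'.1.le]; exact hx'.2),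
      ← C.ofReal_genFun]
    refine le_trans (le_of_eq ?_) (Complex.abs_re_le_norm _)
    simp

end MixedClass

/-! ### The tuned parameter and the main theorem -/

theorem tendsto_tunedParam {x₀ : ℝ} (hx₀ : 0 < x₀) :
    Tendsto (tunedParam x₀) atTop (𝓝[<] x₀) := by
  refine tendsto_nhdsWithin_iff.mpr ⟨?_, ?_⟩
  · have h1 : Tendsto (fun n : ℕ => (1 - 1 / 2 * (1 / (n : ℝ))) * x₀) atTop
        (𝓝 ((1 - 1 / 2 * 0) * x₀)) :=
      ((tendsto_one_div_atTop_nhds_zero_nat.const_mul _).const_sub _).mul_const _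
    refine (h1.congr fun n => ?_).trans (by simp)
    rw [tunedParam, one_div_mul_one_div]
  · filter_upwards [eventually_gt_atTop 0] with n hn
    have : (0 : ℝ) < n := by exact_mod_cast hn
    have : 0 < 1 / (2 * (n : ℝ)) := by positivity
    simp only [tunedParam, Set.mem_Iio]
    nlinarith

theorem half_le_tunedParam {x₀ : ℝ} (hx₀ : 0 < x₀) {n : ℕ} (hn : 0 < n) :
    x₀ / 2 ≤ tunedParam x₀ n := by
  have : (1 : ℝ) ≤ n := by exact_mod_cast hn
  have : 1 / (2 * (n : ℝ)) ≤ 1 / 2 := by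
    apply one_div_le_one_div_of_le <;> linarith
  simp only [tunedParam]
  nlinarith

theorem tunedParam_lt {x₀ : ℝ} (hx₀ : 0 < x₀) {n : ℕ} (hn : 0 < n) : tunedParam x₀ n < x₀ := by
  have : (0 : ℝ) < n := by exact_mod_cast hn
  have : 0 < 1 / (2 * (n : ℝ)) := by positivity
  simp only [tunedParam]
  nlinarith

/-- Bernoulli gives (1 - 1/(2n))^n ≥ 1/2; square it. -/
theorem quarter_mul_pow_le_tunedParam_pow {x₀ : ℝ} (hx₀ : 0 < x₀) {n k : ℕ} (hn : 0 < n)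
    (hk : k ≤ 2 * n) : 1 / 4 * x₀ ^ k ≤ tunedParam x₀ n ^ k := by
  have h1 : (1 : ℝ) ≤ n := by exact_mod_cast hn
  have h2 : 1 / (2 * (n : ℝ)) ≤ 1 / 2 := by
    apply one_div_le_one_div_of_le <;> linarith
  have h3 : 0 < 1 / (2 * (n : ℝ)) := by positivity
  have h4 : (1 / 2 : ℝ) ≤ (1 - 1 / (2 * (n : ℝ))) ^ n := by
    have := one_add_mul_le_pow (a := -(1 / (2 * (n : ℝ)))) (by linarith) n
    rw [← sub_eq_add_neg] at this
    refine le_trans (le_of_eq ?_) this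
    field_simp
    norm_num
  rw [tunedParam, mul_pow]
  gcongr
  calc (1 / 4 : ℝ) = (1 / 2) ^ 2 := by norm_num
    _ ≤ ((1 - 1 / (2 * (n : ℝ))) ^ n) ^ 2 := by gcongr
    _ = (1 - 1 / (2 * (n : ℝ))) ^ (2 * n) := by rw [← pow_mul, mul_comm n]
    _ ≤ _ := pow_le_pow_of_le_one (by linarith) (by linarith) hk

/-- In `ℝ≥0∞` the inverse of 0 is `⊤`, so a finite bound on p⁻¹ also says that p is positive. -/
theorem inv_le_ofReal_of_ofReal_inv_le {a : ℝ} {p : ℝ≥0∞} (ha : 0 < a)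
    (h : ENNReal.ofReal a⁻¹ ≤ p) : p⁻¹ ≤ ENNReal.ofReal a := by
  rw [ENNReal.ofReal_inv_of_pos ha] at h
  exact ENNReal.inv_le_iff_inv_le.mp h

open MixedClass in
theorem mainTheorem7 (C : MixedClass.{u}) (hC : C.HasSquareRootSingularities)
    (Γ : ℝ → ℝ → PMF C.Object) (hΓ : C.IsBoltzmannSampler Γ)
    (x₀ y₀ : ℝ) (h₀ : C.IsSingularPoint x₀ y₀) :
    (∃ K : ℝ, ∀ᶠ n : ℕ in atTop,
      (MixedClass.probSize (Γ (tunedParam x₀ n) y₀) {n})⁻¹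
        ≤ ENNReal.ofReal (K * (n : ℝ) ^ (3 / 2 : ℝ))) ∧
    (∃ K : ℝ, ∀ E : ℝ, 0 < E → ∀ᶠ n : ℕ in atTop, ∀ ε : ℝ, 0 < ε → ε ≤ E →
      (MixedClass.probSize (Γ (tunedParam x₀ n) y₀) (sizeWindow n ε))⁻¹
        ≤ ENNReal.ofReal (K * ((n : ℝ) ^ (1 / 2 : ℝ) / ε))) ∧
    (∃ K : ℝ, ∀ᶠ n : ℕ in atTop,
      MixedClass.expectedSize (Γ (tunedParam x₀ n) y₀)
        ≤ ENNReal.ofReal (K * (n : ℝ) ^ (1 / 2 : ℝ))) := by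
  obtain ⟨⟨δ, hδ, hcoeff⟩, L, M, hM, hgen⟩ := hC.bounds h₀
  have hx₀ := h₀.1
  have hy₀ := h₀.2.1
  have htuned := (tendsto_tunedParam hx₀).eventually hgen
  obtain ⟨N, hN⟩ := eventually_atTop.mp (hcoeff.and htuned)
  -- From k₀ on both analytic bounds hold; c_(k₀) > 0 also makes C(x₀/2, y₀) positive and serves for
  -- windows with ε > 1.
  set k₀ := max N 1 with hk₀
  have hcpos : 0 < C.coeff y₀ k₀ := by
    have h1 := (hN k₀ (le_max_left _ _)).1
    have h2 : 0 < (k₀ : ℝ) := by exact_mod_cast lt_of_lt_of_le one_pos (le_max_right N 1)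
    have h3 : 0 < δ * (k₀ : ℝ) ^ (-(3 / 2) : ℝ) := by positivity
    exact pos_of_mul_pos_left (h3.trans_le h1) (by positivity)
  -- bounds for the generating function
  set b : ℝ := C.genFun (x₀ / 2) y₀ with hb
  have hb0 : 0 < b := by
    have h1 := h₀.summable_term (x := x₀ / 2) (by linarith) (by linarith)
    obtain ⟨γ⟩ : Nonempty {γ : C.Object // C.lsize γ = k₀} := by
      by_contra hem
      rw [not_nonempty_iff] at hem
      rw [coeff, tsum_empty] at hcpos
      exact lt_irrefl _ hcpos
    refine h1.tsum_pos (C.term_nonneg (by linarith) hy₀.le) γ.1 ?_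
    unfold term; positivity
  set B : ℝ := |L| + M * x₀ ^ (1 / 2 : ℝ) with hB
  have hgenB : ∀ n ≥ k₀, b ≤ C.genFun (tunedParam x₀ n) y₀ ∧
      C.genFun (tunedParam x₀ n) y₀ ≤ B := by
    intro n hn
    have hn0 : 0 < n := lt_of_lt_of_le one_pos ((le_max_right N 1).trans hn)
    have h1 := half_le_tunedParam hx₀ hn0
    have h2 := tunedParam_lt hx₀ hn0
    constructor
    · exact Summable.tsum_le_tsum (C.term_mono (by linarith) h1 hy₀.le)
        (h₀.summable_term (by linarith) (by linarith)) (h₀.summable_term (by linarith) h2)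
    · have h3 := (hN n ((le_max_left _ _).trans hn)).2
      have h4 : (x₀ - tunedParam x₀ n) ^ (1 / 2 : ℝ) ≤ x₀ ^ (1 / 2 : ℝ) :=
        Real.rpow_le_rpow (by linarith) (by linarith) (by norm_num)
      have h5 := mul_le_mul_of_nonneg_left h4 hM.le
      have h6 := (abs_le.mp h3).2
      linarith [le_abs_self L]
  have hB0 : 0 < B := hb0.trans_le ((hgenB k₀ le_rfl).1.trans (hgenB k₀ le_rfl).2)
  -- lower bound for the probability of each size in `[n, 2n]`
  set p : ℝ := δ * 2 ^ (-(3 / 2) : ℝ) / 4 / B with hp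
  have hp0 : 0 < p := by positivity
  have hlow : ∀ n ≥ k₀, ∀ k, n ≤ k → k ≤ 2 * n →
      ENNReal.ofReal (p * (n : ℝ) ^ (-(3 / 2) : ℝ)) ≤ probSize (Γ (tunedParam x₀ n) y₀) {k} := by
    intro n hn k hnk hk
    have hn0 : 0 < n := lt_of_lt_of_le one_pos ((le_max_right N 1).trans hn)
    have hn0' : (0 : ℝ) < n := by exact_mod_cast hn0
    have hk0' : (0 : ℝ) < k := by exact_mod_cast hn0.trans_le hnk
    have h1 := half_le_tunedParam hx₀ hn0
    rw [hΓ.probSize_singleton h₀ (by linarith) (tunedParam_lt hx₀ hn0)]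
    refine ENNReal.ofReal_le_ofReal ?_
    have h2 := (hN k ((le_max_left _ _).trans (hn.trans hnk))).1
    have h3 := hgenB n hn
    have h4 := quarter_mul_pow_le_tunedParam_pow hx₀ hn0 hk
    have h5 : (2 : ℝ) ^ (-(3 / 2) : ℝ) * (n : ℝ) ^ (-(3 / 2) : ℝ) ≤ (k : ℝ) ^ (-(3 / 2) : ℝ) := by
      rw [← Real.mul_rpow (by norm_num) hn0'.le]
      exact Real.rpow_le_rpow_of_nonpos hk0' (by exact_mod_cast hk) (by norm_num)
    have hc0 := C.coeff_nonneg hy₀.le k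
    have hb1 := hb0.trans_le h3.1
    calc p * (n : ℝ) ^ (-(3 / 2) : ℝ)
        = δ * (2 ^ (-(3 / 2) : ℝ) * (n : ℝ) ^ (-(3 / 2) : ℝ)) * (1 / 4) / B := by rw [hp]; ring
      _ ≤ δ * (k : ℝ) ^ (-(3 / 2) : ℝ) * (1 / 4) / B := by gcongr
      _ ≤ C.coeff y₀ k * x₀ ^ k * (1 / 4) / B := by gcongr
      _ = C.coeff y₀ k * (1 / 4 * x₀ ^ k) / B := by ring
      _ ≤ C.coeff y₀ k * tunedParam x₀ n ^ k / C.genFun (tunedParam x₀ n) y₀ := by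
        have h6 := (by positivity : 0 ≤ 1 / 4 * x₀ ^ k).trans h4
        gcongr
        exact h3.2
  refine ⟨⟨p⁻¹, ?_⟩, ⟨p⁻¹, fun E hE => ?_⟩, ?_⟩
  · filter_upwards [eventually_ge_atTop k₀] with n hn
    have hn0 : (0 : ℝ) < n := by
      exact_mod_cast lt_of_lt_of_le one_pos ((le_max_right N 1).trans hn)
    refine inv_le_ofReal_of_ofReal_inv_le (by positivity) ?_
    rw [mul_inv, inv_inv, ← Real.rpow_neg hn0.le]
    exact hlow n hn n le_rfl (by omega)
  -- A lower bound, independent of n, for the probability of size k₀. Only the threshold for n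
  -- depends on E, not the constant p⁻¹.
  · set s : ℝ := C.coeff y₀ k₀ * (x₀ / 2) ^ k₀ / B with hs
    have hs0 : 0 < s := by positivity
    have hlarge : ∀ᶠ n : ℕ in atTop, p * E / s ≤ (n : ℝ) ^ (1 / 2 : ℝ) :=
      ((tendsto_rpow_atTop (by norm_num)).comp tendsto_natCast_atTop_atTop).eventually_ge_atTop _
    filter_upwards [eventually_ge_atTop k₀, hlarge] with n hn hnE ε hε hεE
    have hn1 : 0 < n := lt_of_lt_of_le one_pos ((le_max_right N 1).trans hn)
    have hn0 : (0 : ℝ) < n := by exact_mod_cast hn1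
    refine inv_le_ofReal_of_ofReal_inv_le (by positivity) ?_
    rcases le_or_gt ε 1 with hε1 | hε1
    -- The sizes n, …, m number m + 1 - n > nε, even when nε < 1 and only n itself is left.
    · set m : ℕ := ⌊(n : ℝ) * (1 + ε)⌋₊ with hm
      have hm1 : (m : ℝ) ≤ n * (1 + ε) := Nat.floor_le (by positivity)
      have hm2 : (n : ℝ) * (1 + ε) < m + 1 := Nat.lt_floor_add_one _
      have hm3 : m ≤ 2 * n := by
        have : (m : ℝ) ≤ 2 * n := by nlinarith
        exact_mod_cast this
      have hnm : n ≤ m := Nat.le_floor (by nlinarith)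
      refine le_trans ?_ (sum_probSize_singleton_le _ (Finset.Icc n m) _ ?_)
      · refine le_trans ?_ (Finset.card_nsmul_le_sum _ _ _ fun k hk =>
          hlow n hn k (Finset.mem_Icc.mp hk).1 ((Finset.mem_Icc.mp hk).2.trans hm3))
        rw [← ENNReal.ofReal_nsmul]
        refine ENNReal.ofReal_le_ofReal ?_
        rw [Nat.card_Icc, nsmul_eq_mul, Nat.cast_sub (by omega)]
        push_cast
        have e1 : (n : ℝ) ^ (-(3 / 2) : ℝ) = ((n : ℝ) ^ (1 / 2 : ℝ))⁻¹ * (n : ℝ)⁻¹ := by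
          rw [← Real.rpow_neg hn0.le, ← Real.rpow_neg_one, ← Real.rpow_add hn0]
          norm_num
        calc (p⁻¹ * ((n : ℝ) ^ (1 / 2 : ℝ) / ε))⁻¹
            = n * ε * (p * (n : ℝ) ^ (-(3 / 2) : ℝ)) := by rw [e1]; field_simp
          _ ≤ _ := by
            gcongr
            linarith
      · intro k hk
        rw [Finset.coe_Icc, Set.mem_Icc] at hk
        have h1 : (n : ℝ) ≤ k := by exact_mod_cast hk.1
        have h2 : (k : ℝ) ≤ m := by exact_mod_cast hk.2
        exact ⟨by nlinarith, by linarith⟩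
    -- For ε > 1 the left end of the window is negative, so k₀ ≤ n lies in it; its probability s
    -- exceeds pE/n^(1/2) for large n.
    · refine le_trans ?_ (sum_probSize_singleton_le _ {k₀} _ ?_)
      · have h1 := half_le_tunedParam hx₀ hn1
        rw [Finset.sum_singleton, hΓ.probSize_singleton h₀ (by linarith) (tunedParam_lt hx₀ hn1)]
        refine ENNReal.ofReal_le_ofReal ?_
        have h2 := hgenB n hn
        have hb1 := hb0.trans_le h2.1
        rw [div_le_iff₀ hs0] at hnE
        calc (p⁻¹ * ((n : ℝ) ^ (1 / 2 : ℝ) / ε))⁻¹ = p * ε / (n : ℝ) ^ (1 / 2 : ℝ) := by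
              field_simp
          _ ≤ p * E / (n : ℝ) ^ (1 / 2 : ℝ) := by gcongr
          _ ≤ s := by rw [div_le_iff₀ (by positivity)]; linarith
          _ ≤ _ := by
            have h3 : 0 ≤ tunedParam x₀ n := by linarith
            rw [hs]
            gcongr
            exact h2.2
      · intro k hk
        rw [Finset.coe_singleton, Set.mem_singleton_iff] at hk
        have h1 : (k : ℝ) ≤ n := by exact_mod_cast hk ▸ hn
        have h2 : (0 : ℝ) ≤ k := Nat.cast_nonneg k
        exact ⟨by nlinarith, by nlinarith⟩
  · refine ⟨2 * M * x₀ ^ (1 / 2 : ℝ) * 4 / b, ?_⟩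
    filter_upwards [eventually_ge_atTop k₀] with n hn
    have hn1 : 0 < n := lt_of_lt_of_le one_pos ((le_max_right N 1).trans hn)
    have hn0 : (0 : ℝ) < n := by exact_mod_cast hn1
    have h1 := half_le_tunedParam hx₀ hn1
    -- The secant runs from x_n to x_(2n), both within O(1/n) of x₀; so C changes by O(n^(-1/2))
    -- between them.
    have hd : tunedParam x₀ (2 * n) - tunedParam x₀ n = x₀ / (4 * n) := by
      simp only [tunedParam]; push_cast; field_simp; ring
    have hd0 : 0 < x₀ / (4 * n) := by positivity
    have h2 := tunedParam_lt hx₀ hn1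
    have h2' := tunedParam_lt hx₀ (n := 2 * n) (by omega)
    refine (hΓ.expectedSize_le h₀ (x := tunedParam x₀ n) (x' := tunedParam x₀ (2 * n))
      (by linarith) (by linarith) h2').trans (ENNReal.ofReal_le_ofReal ?_)
    have h3 := (hN n ((le_max_left _ _).trans hn)).2
    have h4 := (hN (2 * n) ((le_max_left _ _).trans (hn.trans (by omega)))).2
    have h5 := (hgenB n hn).1
    have e1 : x₀ - tunedParam x₀ n = x₀ / (2 * n) := by
      simp only [tunedParam]; field_simp; ring
    have h6 : (x₀ - tunedParam x₀ (2 * n)) ^ (1 / 2 : ℝ) ≤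
        (x₀ - tunedParam x₀ n) ^ (1 / 2 : ℝ) :=
      Real.rpow_le_rpow (by linarith) (by linarith) (by norm_num)
    have h7 : (x₀ - tunedParam x₀ n) ^ (1 / 2 : ℝ) ≤ x₀ ^ (1 / 2 : ℝ) / (n : ℝ) ^ (1 / 2 : ℝ) := by
      rw [e1, ← Real.div_rpow hx₀.le hn0.le]
      refine Real.rpow_le_rpow (by positivity) ?_ (by norm_num)
      gcongr
      linarith
    have h8 : C.genFun (tunedParam x₀ (2 * n)) y₀ - C.genFun (tunedParam x₀ n) y₀ ≤
        2 * M * (x₀ ^ (1 / 2 : ℝ) / (n : ℝ) ^ (1 / 2 : ℝ)) := by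
      have := (abs_le.mp h3).1
      have := (abs_le.mp h4).2
      have := mul_le_mul_of_nonneg_left h6 hM.le
      have := mul_le_mul_of_nonneg_left h7 hM.le
      linarith
    have h9 : tunedParam x₀ n / (x₀ / (4 * n)) ≤ 4 * n := by
      rw [div_le_iff₀ hd0]
      refine h2.le.trans (le_of_eq ?_)
      field_simp
    have h10 : 0 ≤ tunedParam x₀ n / (x₀ / (4 * n)) := div_nonneg (by linarith) hd0.le
    rw [hd]
    have e2 : (n : ℝ) = (n : ℝ) ^ (1 / 2 : ℝ) * (n : ℝ) ^ (1 / 2 : ℝ) := by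
      rw [← Real.rpow_add hn0]; norm_num
    calc _ ≤ 2 * M * (x₀ ^ (1 / 2 : ℝ) / (n : ℝ) ^ (1 / 2 : ℝ)) * (4 * n) / b := by
          gcongr
      _ = _ := by
          have : (n : ℝ) ^ (1 / 2 : ℝ) ≠ 0 := by positivity
          nth_rewrite 2 [e2]
          field_simp
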